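/- Let $n,k\ge 0$ be integers, let $x_0,x_1,\dots,x_n$ and $x$ be pairwise distinct points of the interval $[p,q]$, and let $f\in C^{n+k+1}[p,q]$ be real-valued. Put $P(t)=\prod_{i=0}^n (t-x_i)$. For points $a_0\le a_1\le\dots\le a_r$ of $[p,q]$, the divided difference $f[a_0,\dots,a_r]$ is defined by $$f[a_0,\dots,a_r]=\begin{cases}\dfrac{f[a_1,\dots,a_r]-f[a_0,\dots,a_{r-1}]}{a_r-a_0}, & a_0\neq a_r,\\[2mm] \dfrac{f^{(r)}(a_0)}{r!}, & a_0=a_r,\end{cases}$$ and for points listed in any other order it is the divided difference of the same points rearranged in nondecreasing order. Derivatives of $f$ at $p$ and $q$ are one-sided. Write $f[x^{(l)},x_0,\dots,x_n]$ when $x$ is repeated $l$ times. Then: (i) (using the value $f(x)$) $$\frac{f^{(k)}(x)}{k!}=\sum_{0\le i_1<\dots<i_k\le n} f[x_{i_1},\dots,x_{i_k},x]\prod_{\substack{0\le j\le n\\ j\notin\{i_1,\dots,i_k\}}}\frac{(x-x_j)^k}{(x_{i_1}-x_j)\cdots(x_{i_k}-x_j)}+\sum_{m=0}^{k-1} f[x^{(k+1-m)},x_0,\dots,x_n]\,\frac{P^{(m)}(x)}{m!};$$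 (ii) (with no value $f(x)$ in the leading sum) $$\frac{f^{(k)}(x)}{k!}=\sum_{0\le i_1<\dots<i_{k+1}\le n} f[x_{i_1},\dots,x_{i_{k+1}}]\prod_{\substack{0\le j\le n\\ j\notin\{i_1,\dots,i_{k+1}\}}}\frac{(x-x_j)^{k+1}}{(x_{i_1}-x_j)\cdots(x_{i_{k+1}}-x_j)}+\sum_{m=0}^{k} f[x^{(k+1-m)},x_0,\dots,x_n]\,\frac{P^{(m)}(x)}{m!}.$$ Empty sums are $0$ and empty products are $1$. In (i) with $k=0$ the leading sum is the single term $f[x]=f(x)$, for the empty set of indices. -/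

import Mathlib

/-- Divided differences along a nondecreasing sequence of nodes: for a monotone `y`,
`divDiffSeq s f y r i` is `f[y i, y (i+1), …, y (i+r)]`.

It is given by the usual recursion. If the two extreme nodes differ, it is the difference quotient
of the two divided differences of order one less. If they agree then, `y` being monotone, all the
`r + 1` nodes agree, and the confluent divided difference is `f⁽ʳ⁾(y i) / r!`. Derivatives are taken
within `s` (one-sided ones at the end points of an interval). -/
noncomputable def divDiffSeq (s : Set ℝ) (f : ℝ → ℝ) (y : ℕ → ℝ) : ℕ → ℕ → ℝ
  | 0, i => f (y i)
  | r + 1, i =>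
      if y i = y (i + (r + 1)) then
        iteratedDerivWithin (r + 1) f s (y i) / ((r + 1).factorial : ℝ)
      else
        (divDiffSeq s f y r (i + 1) - divDiffSeq s f y r i) / (y (i + (r + 1)) - y i)

/-- The divided difference `f[a₀, a₁, …, aᵣ]` at a nonempty multiset `{a₀, …, aᵣ}` of nodes, where
repeated nodes are allowed: list the nodes in nondecreasing order and use `divDiffSeq`.
(The value at the empty multiset has no meaning.) -/
noncomputable def divDiff (s : Set ℝ) (f : ℝ → ℝ) (M : Multiset ℝ) : ℝ :=
  divDiffSeq s f (fun i => (M.sort (· ≤ ·)).getD i 0) (M.card - 1) 0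

/-! Every divided difference in both formulas depends only on the derivatives of `f` at `x` of order
at most `k` and on its values at the nodes. A polynomial with these data exists, so `f` may be
replaced by it and the problem becomes algebraic. For polynomials, adjoining nodes means dividing by
the corresponding monic product (`polyDivDiff_add`). Write `p = r + W * q` with `W` the nodal
polynomial. The Leibniz rule on `W * q` gives the tail sum, and repeated Lagrange interpolation
expands the Taylor coefficient of `r` (`taylor_coeff_eq_sum_polyDivDiff`). This is (ii); (i) is (ii)
for the quotient of `p` by `X - x`, one order lower. -/

open Polynomial Finset

/-! ### Divided differences of polynomials by division with remainder. -/

section PolynomialDividedDifferences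

variable {F : Type*} [Field F]

/-- The monic polynomial whose roots, with multiplicity, are the elements of `M`. -/
noncomputable def rootPoly (M : Multiset F) : F[X] := (M.map fun a => X - C a).prod

/-- The divided difference of the polynomial `p` at the nodes `M`: the coefficient of degree
`card M - 1` of the Hermite interpolant of `p` at `M`. -/
noncomputable def polyDivDiff (p : F[X]) (M : Multiset F) : F :=
  (p %ₘ rootPoly M).coeff (M.card - 1)

theorem rootPoly_add (M N : Multiset F) : rootPoly (M + N) = rootPoly M * rootPoly N := by
  simp [rootPoly]

theorem rootPoly_singleton (a : F) : rootPoly {a} = X - C a := by simp [rootPoly]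

theorem rootPoly_monic (M : Multiset F) : (rootPoly M).Monic :=
  monic_multiset_prod_of_monic _ _ fun a _ => monic_X_sub_C a

theorem natDegree_rootPoly (M : Multiset F) : (rootPoly M).natDegree = M.card :=
  natDegree_multiset_prod_X_sub_C_eq_card M

theorem degree_rootPoly (M : Multiset F) : (rootPoly M).degree = M.card := by
  rw [degree_eq_natDegree (rootPoly_monic M).ne_zero, natDegree_rootPoly]

theorem rootPoly_val_map {ι : Type*} (A : Finset ι) (v : ι → F) :
    rootPoly (A.val.map v) = Lagrange.nodal A v := by
  rw [rootPoly, Multiset.map_map]; rfl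

theorem degree_modByMonic_rootPoly_lt (p : F[X]) (M : Multiset F) :
    (p %ₘ rootPoly M).degree < M.card :=
  (degree_modByMonic_lt p (rootPoly_monic M)).trans_eq (degree_rootPoly M)

/-- Dividing in two stages splits the remainder modulo the product as `rootPoly M * (q %ₘ rootPoly
N) + p %ₘ rootPoly M`. As `N` is nonempty, the last summand has too low a degree to reach the
coefficient read off, and `rootPoly M` is monic. -/
theorem polyDivDiff_add (p : F[X]) (M : Multiset F) {N : Multiset F} (hN : N ≠ 0) :
    polyDivDiff p (M + N) = polyDivDiff (p /ₘ rootPoly M) N := by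
  have hc : 0 < N.card := Multiset.card_pos.2 hN
  set q := p /ₘ rootPoly M with hq
  have hlt := degree_modByMonic_rootPoly_lt q N
  have hM := degree_modByMonic_rootPoly_lt p M
  have key : p %ₘ rootPoly (M + N) = rootPoly M * (q %ₘ rootPoly N) + p %ₘ rootPoly M := by
    refine (div_modByMonic_unique (q /ₘ rootPoly N) _ (rootPoly_monic _) ⟨?_, ?_⟩).2
    · have h1 := modByMonic_add_div p (rootPoly M)
      have h2 := modByMonic_add_div q (rootPoly N)
      rw [rootPoly_add]
      rw [← hq] at h1
      linear_combination h1 + rootPoly M * h2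
    · rw [degree_rootPoly, Multiset.card_add]
      refine lt_of_le_of_lt (degree_add_le _ _) (max_lt ?_ (hM.trans ?_))
      · rw [degree_mul, degree_rootPoly, Nat.cast_add]
        exact WithBot.add_lt_add_left (by simp) hlt
      · exact_mod_cast Nat.lt_add_of_pos_right hc
  have hcard : (M + N).card - 1 = M.card + (N.card - 1) := by
    rw [Multiset.card_add]; omega
  rw [polyDivDiff, key, hcard, coeff_add,
    coeff_mul_add_eq_of_natDegree_le (natDegree_rootPoly M).le, polyDivDiff]
  · rw [← natDegree_rootPoly M, (rootPoly_monic M).coeff_natDegree, natDegree_rootPoly,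
      coeff_eq_zero_of_degree_lt (hM.trans_le _)]
    · simp
    · exact_mod_cast Nat.le_add_right _ _
  · rw [natDegree_le_iff_degree_le]
    refine degree_le_of_natDegree_le ?_
    by_cases h0 : q %ₘ rootPoly N = 0
    · simp [h0]
    · have := (natDegree_lt_iff_degree_lt h0).2 hlt
      omega

theorem polyDivDiff_singleton (p : F[X]) (a : F) : polyDivDiff p {a} = p.eval a := by
  simp [polyDivDiff, rootPoly_singleton, modByMonic_X_sub_C_eq_C_eval]

theorem polyDivDiff_cons (p : F[X]) (a : F) {M : Multiset F} (hM : M ≠ 0) :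
    polyDivDiff p (a ::ₘ M) = polyDivDiff (p /ₘ (X - C a)) M := by
  rw [← Multiset.singleton_add, polyDivDiff_add _ _ hM, rootPoly_singleton]

theorem polyDivDiff_cons_eq_eval (p : F[X]) (a : F) (M : Multiset F) :
    polyDivDiff p (a ::ₘ M) = (p /ₘ rootPoly M).eval a := by
  rw [← Multiset.singleton_add, add_comm, polyDivDiff_add _ _ (Multiset.singleton_ne_zero a),
    polyDivDiff_singleton]

/-- With `q = p /ₘ rootPoly M`, this is division of `q` by `X - a`, evaluated at `b`. -/
theorem polyDivDiff_recursion (p : F[X]) (a b : F) (M : Multiset F) :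
    (b - a) * polyDivDiff p (a ::ₘ b ::ₘ M) =
      polyDivDiff p (b ::ₘ M) - polyDivDiff p (a ::ₘ M) := by
  set q := p /ₘ rootPoly M with hq
  have h : polyDivDiff p (a ::ₘ b ::ₘ M) = (q /ₘ (X - C a)).eval b := by
    rw [show a ::ₘ b ::ₘ M = M + b ::ₘ {a} by
        rw [Multiset.cons_swap, ← Multiset.singleton_add, ← Multiset.singleton_add,
          ← Multiset.singleton_add, add_comm M, add_assoc],
      polyDivDiff_add _ _ (Multiset.cons_ne_zero), polyDivDiff_cons_eq_eval, rootPoly_singleton]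
  have hd := congrArg (eval b) (modByMonic_add_div q (X - C a))
  rw [modByMonic_X_sub_C_eq_C_eval] at hd
  simp only [eval_add, eval_mul, eval_sub, eval_X, eval_C] at hd
  rw [h, polyDivDiff_cons_eq_eval, polyDivDiff_cons_eq_eval, ← hq]
  linear_combination hd

theorem polyDivDiff_replicate (a : F) (r : ℕ) (p : F[X]) :
    polyDivDiff p (Multiset.replicate (r + 1) a) = (taylor a p).coeff r := by
  induction r generalizing p with
  | zero => simp [polyDivDiff_singleton, taylor_coeff_zero]
  | succ r ih =>
    rw [Multiset.replicate_succ, polyDivDiff_cons _ _ (by simp [Multiset.replicate_succ]), ih]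
    conv_rhs => rw [← modByMonic_add_div p (X - C a)]
    rw [modByMonic_X_sub_C_eq_C_eval, map_add, taylor_C, taylor_mul, map_sub, taylor_X, taylor_C,
      add_sub_cancel_right, coeff_add, coeff_X_mul, coeff_C_succ, zero_add]

theorem polyDivDiff_modByMonic (p : F[X]) {M N : Multiset F} (h : M ≤ N) :
    polyDivDiff (p %ₘ rootPoly N) M = polyDivDiff p M := by
  obtain ⟨K, rfl⟩ := Multiset.le_iff_exists_add.1 h
  have hd : rootPoly M ∣ p %ₘ rootPoly (M + K) - p := by
    refine ⟨-(rootPoly K * (p /ₘ rootPoly (M + K))), ?_⟩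
    have := modByMonic_add_div p (rootPoly (M + K))
    rw [rootPoly_add] at this ⊢
    linear_combination this
  rw [polyDivDiff, polyDivDiff, modByMonic_eq_of_dvd_sub (rootPoly_monic M) hd]

/-! ### Lagrange interpolation and the expansion of Taylor coefficients. -/

variable {ι : Type*} [DecidableEq ι]

theorem eval_lagrangeBasis (s : Finset ι) (v : ι → F) (i : ι) (x : F) :
    (Lagrange.basis s v i).eval x = ∏ j ∈ s.erase i, (x - v j) / (v i - v j) := by
  rw [Lagrange.basis, eval_prod]
  refine prod_congr rfl fun j _ => ?_
  simp [Lagrange.basisDivisor, div_eq_inv_mul]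

theorem eval_eq_sum_lagrange {s : Finset ι} {v : ι → F} (hv : Set.InjOn v s) {p : F[X]}
    (hp : p.degree < #s) (x : F) :
    p.eval x = ∑ i ∈ s, p.eval (v i) * ∏ j ∈ s.erase i, (x - v j) / (v i - v j) := by
  conv_lhs => rw [Lagrange.eq_interpolate hv hp, Lagrange.interpolate_apply, eval_finsetSum]
  exact sum_congr rfl fun i _ => by rw [eval_mul, eval_C, eval_lagrangeBasis]

theorem sum_lagrange_eq_one {s : Finset ι} {v : ι → F} (hv : Set.InjOn v s) (hs : s.Nonempty)
    (x : F) : ∑ i ∈ s, ∏ j ∈ s.erase i, (x - v j) / (v i - v j) = 1 := by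
  have h := congrArg (eval x) (Lagrange.sum_basis hv hs)
  rw [eval_finsetSum, eval_one] at h
  simpa only [eval_lagrangeBasis] using h

theorem sum_powersetCard_erase {M : Type*} [AddCommMonoid M] (A : Finset ι) (k : ℕ)
    (f : ι → Finset ι → M) :
    ∑ i ∈ A, ∑ S ∈ (A.erase i).powersetCard k, f i S =
      ∑ S ∈ A.powersetCard (k + 1), ∑ i ∈ S, f i (S.erase i) := by
  rw [sum_sigma', sum_sigma']
  refine sum_bij' (fun a _ => ⟨insert a.1 a.2, a.1⟩) (fun b _ => ⟨b.2, b.1.erase b.2⟩) ?_ ?_ ?_ ?_ ?_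
  · rintro ⟨i, S⟩ h
    simp only [mem_sigma, mem_powersetCard, subset_erase] at h ⊢
    exact ⟨⟨insert_subset h.1 h.2.1.1, by rw [card_insert_of_notMem h.2.1.2, h.2.2]⟩,
      mem_insert_self _ _⟩
  · rintro ⟨S, i⟩ h
    simp only [mem_sigma, mem_powersetCard] at h ⊢
    exact ⟨h.1.1 h.2, erase_subset_erase _ h.1.1, by rw [card_erase_of_mem h.2, h.1.2]; rfl⟩
  · rintro ⟨i, S⟩ h
    simp only [mem_sigma, mem_powersetCard, subset_erase] at h
    simp [erase_insert h.2.1.2]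
  · rintro ⟨S, i⟩ h
    simp only [mem_sigma] at h
    simp [insert_erase h.2]
  · rintro ⟨i, S⟩ h
    simp only [mem_sigma, mem_powersetCard, subset_erase] at h
    simp [erase_insert h.2.1.2]

theorem degree_divByMonic_X_sub_C_lt {p : F[X]} {n : ℕ} (hp : p.degree < (n + 1 : ℕ)) (a : F) :
    (p /ₘ (X - C a)).degree < n := by
  by_cases h0 : p /ₘ (X - C a) = 0
  · rw [h0, degree_zero]; exact WithBot.bot_lt_coe n
  · have hp0 : p ≠ 0 := by rintro rfl; simp at h0
    rw [← natDegree_lt_iff_degree_lt h0]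
    have h1 := (natDegree_lt_iff_degree_lt hp0).2 hp
    have h2 : p.natDegree ≠ 0 := fun h => h0 <| by
      rw [divByMonic_eq_zero_iff (monic_X_sub_C a), degree_X_sub_C, degree_eq_natDegree hp0, h]
      exact zero_lt_one
    rw [natDegree_divByMonic _ (monic_X_sub_C a), natDegree_X_sub_C]
    omega

/-- Induction on `k`: Lagrange interpolation trades one copy of `x` for a node `v i`, and the rest
is the same problem on `A.erase i`. -/
theorem taylor_coeff_eq_sum_polyDivDiff {v : ι → F} (x : F) (k : ℕ) {A : Finset ι}
    (hv : Set.InjOn v A) {p : F[X]} (hp : p.degree < #A) :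
    (taylor x p).coeff k = ∑ S ∈ A.powersetCard (k + 1), polyDivDiff p (S.val.map v) *
      ∏ j ∈ A \ S, ((x - v j) ^ (k + 1) / ∏ i ∈ S, (v i - v j)) := by
  induction k generalizing A p with
  | zero =>
    rw [taylor_coeff_zero, eval_eq_sum_lagrange hv hp, zero_add, powersetCard_one, sum_map]
    refine sum_congr rfl fun i _ => ?_
    simp [polyDivDiff_singleton, sdiff_singleton_eq_erase]
  | succ k ih =>
    have hdeg : (p /ₘ rootPoly (Multiset.replicate (k + 1) x)).degree < #A :=
      (degree_divByMonic_le _ _).trans_lt hp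
    rw [← polyDivDiff_replicate, Multiset.replicate_succ, polyDivDiff_cons_eq_eval,
      eval_eq_sum_lagrange hv hdeg]
    -- This value is the divided difference at `k + 1` copies of `x` and `v i`. Removing `v i`
    -- instead of `x` makes it a Taylor coefficient of order `k` of a quotient of smaller degree.
    have hterm : ∀ i ∈ A, (p /ₘ rootPoly (Multiset.replicate (k + 1) x)).eval (v i) =
        ∑ S ∈ (A.erase i).powersetCard (k + 1),
          polyDivDiff (p /ₘ (X - C (v i))) (S.val.map v) *
            ∏ j ∈ A.erase i \ S, ((x - v j) ^ (k + 1) / ∏ l ∈ S, (v l - v j)) := by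
      intro i hi
      rw [← polyDivDiff_cons_eq_eval, polyDivDiff_cons _ _ (by simp [Multiset.replicate_succ]),
        polyDivDiff_replicate]
      refine ih (hv.mono (by simp)) (degree_divByMonic_X_sub_C_lt ?_ _)
      rwa [card_erase_add_one hi]
    rw [sum_congr rfl fun i hi => by rw [hterm i hi, sum_mul], sum_powersetCard_erase]
    refine sum_congr rfl fun S hS => ?_
    rw [mem_powersetCard] at hS
    have hne : S.Nonempty := card_pos.1 (by omega)
    -- Each `S` arises once for every `i ∈ S`, weighted by the Lagrange basis of `S` at `x`; these
    -- weights sum to 1.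
    rw [← mul_one (polyDivDiff p _ * _),
      ← sum_lagrange_eq_one (hv.mono (coe_subset.2 hS.1)) hne x, mul_sum]
    refine sum_congr rfl fun i hi => ?_
    have hval : S.val.map v = v i ::ₘ (S.erase i).val.map v := by
      conv_lhs => rw [← insert_erase hi, insert_val_of_notMem (notMem_erase i S)]
      simp
    have hne' : (S.erase i).val.map v ≠ 0 := by
      rw [← Multiset.card_pos, Multiset.card_map, card_val, card_erase_of_mem hi]
      omega
    have hsd : A.erase i \ S.erase i = A \ S := by
      ext j
      simp only [mem_sdiff, mem_erase]
      by_cases hj : j = i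
      · subst hj; simp [hi]
      · simp [hj]
    have hun : A.erase i = S.erase i ∪ A \ S := by
      rw [← hsd, union_sdiff_of_subset (erase_subset_erase _ hS.1)]
    have hdisj : Disjoint (S.erase i) (A \ S) :=
      disjoint_sdiff.mono_left (erase_subset _ _)
    rw [hval, polyDivDiff_cons _ _ hne', hsd, hun, prod_union hdisj, mul_assoc, mul_assoc]
    congr 1
    rw [mul_comm (∏ j ∈ S.erase i, _), ← mul_assoc, ← prod_mul_distrib]
    congr 1
    refine prod_congr rfl fun j _ => ?_
    rw [← mul_prod_erase S _ hi, div_mul_div_comm, ← pow_succ, mul_comm (v i - v j)]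

theorem taylor_coeff_eq_sum_add_sum {v : ι → F} (x : F) (k : ℕ) {A : Finset ι}
    (hv : Set.InjOn v A) (p : F[X]) :
    (taylor x p).coeff k = (∑ S ∈ A.powersetCard (k + 1), polyDivDiff p (S.val.map v) *
        ∏ j ∈ A \ S, ((x - v j) ^ (k + 1) / ∏ i ∈ S, (v i - v j))) +
      ∑ m ∈ range (k + 1),
        polyDivDiff p (Multiset.replicate (k + 1 - m) x + A.val.map v) *
          (taylor x (Lagrange.nodal A v)).coeff m := by
  have hW := rootPoly_val_map A v
  have hdeg : (p %ₘ rootPoly (A.val.map v)).degree < #A := by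
    simpa using degree_modByMonic_rootPoly_lt p (A.val.map v)
  conv_lhs => rw [← modByMonic_add_div p (rootPoly (A.val.map v))]
  rw [map_add, coeff_add, taylor_coeff_eq_sum_polyDivDiff x k hv hdeg, taylor_mul, coeff_mul,
    Nat.sum_antidiagonal_eq_sum_range_succ
      (fun i j => (taylor x (rootPoly (A.val.map v))).coeff i *
        (taylor x (p /ₘ rootPoly (A.val.map v))).coeff j)]
  congr 1
  · refine sum_congr rfl fun S hS => ?_
    rw [polyDivDiff_modByMonic p
      (Multiset.map_le_map (val_le_iff.2 (mem_powersetCard.1 hS).1))]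
  · refine sum_congr rfl fun m hm => ?_
    have hm' : k + 1 - m = k - m + 1 := by rw [mem_range] at hm; omega
    rw [hm', add_comm (Multiset.replicate _ x),
      polyDivDiff_add _ _ (by simp [Multiset.replicate_succ]), polyDivDiff_replicate, hW, mul_comm]

/-- For positive `k`, dividing `p` by `X - x` lowers the Taylor order by one, and each divided
difference of the quotient is one of `p` with an extra node `x`. -/
theorem taylor_coeff_eq_sum_cons_add_sum {v : ι → F} (x : F) (k : ℕ) {A : Finset ι}
    (hv : Set.InjOn v A) (p : F[X]) :
    (taylor x p).coeff k = (∑ S ∈ A.powersetCard k, polyDivDiff p (x ::ₘ S.val.map v) *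
        ∏ j ∈ A \ S, ((x - v j) ^ k / ∏ i ∈ S, (v i - v j))) +
      ∑ m ∈ range k,
        polyDivDiff p (Multiset.replicate (k + 1 - m) x + A.val.map v) *
          (taylor x (Lagrange.nodal A v)).coeff m := by
  cases k with
  | zero => simp [polyDivDiff_singleton, taylor_coeff_zero]
  | succ k =>
    rw [← polyDivDiff_replicate, Multiset.replicate_succ,
      polyDivDiff_cons _ _ (by simp [Multiset.replicate_succ]), polyDivDiff_replicate,
      taylor_coeff_eq_sum_add_sum x k hv]
    congr 1
    · refine sum_congr rfl fun S hS => ?_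
      rw [polyDivDiff_cons]
      rw [← Multiset.card_pos, Multiset.card_map, card_val, (mem_powersetCard.1 hS).2]
      omega
    · refine sum_congr rfl fun m hm => ?_
      have hm' : k + 1 + 1 - m = k + 1 - m + 1 := by rw [mem_range] at hm; omega
      rw [hm', Multiset.replicate_succ, Multiset.cons_add, polyDivDiff_cons]
      rw [← Multiset.card_pos, Multiset.card_add, Multiset.card_replicate]
      rw [mem_range] at hm
      omega

/-- Existence of a polynomial with prescribed Taylor coefficients at `x` and prescribed values at
further nodes. -/
theorem exists_taylor_coeff_eq_and_eval_eq {v : ι → F} {A : Finset ι} (hv : Set.InjOn v A) (x : F)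
    (hx : ∀ i ∈ A, x ≠ v i) (k : ℕ) (c : ℕ → F) (g : ι → F) :
    ∃ p : F[X], (∀ m < k, (taylor x p).coeff m = c m) ∧ ∀ i ∈ A, p.eval (v i) = g i := by
  -- `T` carries the prescribed Taylor coefficients. A multiple of `(X - C x) ^ k` leaves them
  -- intact and can correct the values at the nodes, where `X - C x` does not vanish.
  set T : F[X] := taylor (-x) (∑ m ∈ range k, C (c m) * X ^ m) with hT
  refine ⟨T + (X - C x) ^ k * Lagrange.interpolate A v
    (fun i => (g i - T.eval (v i)) / (v i - x) ^ k), fun m hm => ?_, fun i hi => ?_⟩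
  · rw [map_add, taylor_mul, taylor_pow, map_sub, taylor_X, taylor_C, add_sub_cancel_right,
      coeff_add, hT, taylor_taylor, add_neg_cancel, taylor_zero, finsetSum_coeff,
      coeff_X_pow_mul', if_neg (by omega), add_zero]
    simp [coeff_X_pow, hm]
  · have h0 : v i - x ≠ 0 := sub_ne_zero.2 (hx i hi).symm
    rw [eval_add, eval_mul, Lagrange.eval_interpolate_at_node _ hv hi]
    simp only [eval_pow, eval_sub, eval_X, eval_C]
    field_simp
    ring

end PolynomialDividedDifferences

/-! ### Passage from functions to interpolating polynomials. -/

theorem divDiffSeq_eq_polyDivDiff (s : Set ℝ) (f : ℝ → ℝ) (y : ℕ → ℝ) (p : ℝ[X]) (r i : ℕ)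
    (hy : ∀ a b, i ≤ a → a ≤ b → b ≤ i + r → y a ≤ y b)
    (hp : ∀ a b, Multiset.replicate (a + 1) b ≤ ((List.range' i (r + 1)).map y : Multiset ℝ) →
      iteratedDerivWithin a f s b / (a.factorial : ℝ) = (taylor b p).coeff a) :
    divDiffSeq s f y r i = polyDivDiff p ((List.range' i (r + 1)).map y : Multiset ℝ) := by
  induction r generalizing i with
  | zero =>
    have := hp 0 (y i) (by simp)
    simpa [divDiffSeq, polyDivDiff_singleton, taylor_coeff_zero] using this
  | succ r ih =>
    have e1 : ((List.range' i (r + 1 + 1)).map y : Multiset ℝ) =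
        y i ::ₘ ((List.range' (i + 1) (r + 1)).map y : Multiset ℝ) := by
      rw [List.range'_succ]; simp
    have e2 : ((List.range' (i + 1) (r + 1)).map y : Multiset ℝ) =
        y (i + (r + 1)) ::ₘ ((List.range' (i + 1) r).map y : Multiset ℝ) := by
      rw [List.range'_concat, List.map_append, ← Multiset.coe_add, add_comm]
      rw [← Multiset.singleton_add]
      congr 2
      simp [add_comm, add_left_comm]
    have e3 : ((List.range' i (r + 1)).map y : Multiset ℝ) =
        y i ::ₘ ((List.range' (i + 1) r).map y : Multiset ℝ) := by
      rw [List.range'_succ]; simp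
    rw [divDiffSeq]
    split_ifs with h
    · have hrep : ((List.range' i (r + 1 + 1)).map y : Multiset ℝ) =
          Multiset.replicate (r + 1 + 1) (y i) := by
        rw [Multiset.eq_replicate]
        refine ⟨by simp, fun b hb => ?_⟩
        simp only [Multiset.mem_coe, List.mem_map, List.mem_range'_1] at hb
        obtain ⟨a, ha, rfl⟩ := hb
        exact le_antisymm ((hy a (i + (r + 1)) ha.1 (by omega) le_rfl).trans_eq h.symm)
          (hy i a le_rfl ha.1 (by omega))
      rw [hp (r + 1) (y i) hrep.ge, hrep, polyDivDiff_replicate]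
    · rw [ih (i + 1) (fun a b h1 h2 h3 => hy a b (by omega) h2 (by omega))
          (fun a b hab => hp a b (hab.trans (e1 ▸ Multiset.le_cons_self _ _))),
        ih i (fun a b h1 h2 h3 => hy a b h1 h2 (by omega))
          (fun a b hab => hp a b (hab.trans (by
            rw [e1, e2, Multiset.cons_swap, ← e3]; exact Multiset.le_cons_self _ _))),
        e1, e2, e3, div_eq_iff (sub_ne_zero.2 (Ne.symm h)), ← polyDivDiff_recursion, mul_comm]

theorem divDiff_eq_polyDivDiff (s : Set ℝ) (f : ℝ → ℝ) (p : ℝ[X]) {M : Multiset ℝ} (hM : M ≠ 0)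
    (hp : ∀ a b, Multiset.replicate (a + 1) b ≤ M →
      iteratedDerivWithin a f s b / (a.factorial : ℝ) = (taylor b p).coeff a) :
    divDiff s f M = polyDivDiff p M := by
  have hpos : 0 < M.card := Multiset.card_pos.2 hM
  set L := M.sort (· ≤ ·) with hL
  have hlen : L.length = M.card := Multiset.length_sort _
  have hmap : (List.range' 0 (M.card - 1 + 1)).map (fun i => L.getD i 0) = L := by
    refine List.ext_getElem (by simp; omega) fun n h1 h2 => ?_
    simp [List.getElem?_eq_getElem h2]
  have hcoe : ((List.range' 0 (M.card - 1 + 1)).map (fun i => L.getD i 0) : Multiset ℝ) = M := by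
    rw [hmap, hL, Multiset.sort_eq]
  rw [divDiff, divDiffSeq_eq_polyDivDiff s f _ p, hcoe]
  · intro a b _ hab hb
    have hb' : b < L.length := by omega
    rw [← hL, List.getD_eq_getElem _ _ hb', List.getD_eq_getElem _ _ (hab.trans_lt hb')]
    exact (Multiset.pairwise_sort M (· ≤ ·)).sortedLE.getElem_le_getElem_of_le hab
  · rwa [hcoe]

theorem iteratedDeriv_eval_div_factorial (p : ℝ[X]) (m : ℕ) (x : ℝ) :
    iteratedDeriv m (fun t => p.eval t) x / (m.factorial : ℝ) = (taylor x p).coeff m := by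
  have h : iteratedDeriv m (fun t => p.eval t) = fun t => (derivative^[m] p).eval t := by
    induction m with
    | zero => simp
    | succ m ih =>
      rw [iteratedDeriv_succ, ih, Function.iterate_succ_apply']
      ext t
      exact Polynomial.deriv _
  rw [h, taylor_coeff, ← factorial_smul_hasseDeriv]
  have : (m.factorial : ℝ) ≠ 0 := by exact_mod_cast m.factorial_ne_zero
  simp [nsmul_eq_mul, this]

theorem theorem4p4 (p q : ℝ) (n k : ℕ) (f : ℝ → ℝ)
    (hf : ContDiffOn ℝ ((n + k + 1 : ℕ) : WithTop ℕ∞) f (Set.Icc p q))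
    (x : ℝ) (y : Fin (n + 1) → ℝ)
    (hx : x ∈ Set.Icc p q) (hy : ∀ i, y i ∈ Set.Icc p q)
    (hinj : Function.Injective y) (hxy : ∀ i, x ≠ y i) :
    (iteratedDerivWithin k f (Set.Icc p q) x / (k.factorial : ℝ) =
        (∑ S ∈ (Finset.univ : Finset (Fin (n + 1))).powersetCard k,
          divDiff (Set.Icc p q) f (x ::ₘ S.val.map y) *
            ∏ j ∈ Sᶜ, ((x - y j) ^ k / ∏ i ∈ S, (y i - y j))) +
        ∑ m ∈ Finset.range k,
          divDiff (Set.Icc p q) f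
              (Multiset.replicate (k + 1 - m) x + (Finset.univ : Finset (Fin (n + 1))).val.map y) *
            (iteratedDeriv m (fun t : ℝ => ∏ i, (t - y i)) x / (m.factorial : ℝ))) ∧
    (iteratedDerivWithin k f (Set.Icc p q) x / (k.factorial : ℝ) =
        (∑ S ∈ (Finset.univ : Finset (Fin (n + 1))).powersetCard (k + 1),
          divDiff (Set.Icc p q) f (S.val.map y) *
            ∏ j ∈ Sᶜ, ((x - y j) ^ (k + 1) / ∏ i ∈ S, (y i - y j))) +
        ∑ m ∈ Finset.range (k + 1),
          divDiff (Set.Icc p q) f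
              (Multiset.replicate (k + 1 - m) x + (Finset.univ : Finset (Fin (n + 1))).val.map y) *
            (iteratedDeriv m (fun t : ℝ => ∏ i, (t - y i)) x / (m.factorial : ℝ))) := by
  have hv : Set.InjOn y ((Finset.univ : Finset (Fin (n + 1))) : Set (Fin (n + 1))) := hinj.injOn
  obtain ⟨P, hP, hPy⟩ := exists_taylor_coeff_eq_and_eval_eq hv x (fun i _ => hxy i) (k + 1)
    (fun m => iteratedDerivWithin m f (Set.Icc p q) x / (m.factorial : ℝ)) (fun i => f (y i))
  have hdd : ∀ M : Multiset ℝ, M ≠ 0 →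
      M ≤ Multiset.replicate (k + 1) x + (Finset.univ : Finset (Fin (n + 1))).val.map y →
      divDiff (Set.Icc p q) f M = polyDivDiff P M := by
    intro M hM0 hM
    refine divDiff_eq_polyDivDiff _ _ _ hM0 fun a b hab => ?_
    -- Multiplicities bound the data needed: order at most `k` at `x`, and values alone at the
    -- simple nodes `y i`.
    have hcount := Multiset.le_count_iff_replicate_le.2 (hab.trans hM)
    rw [Multiset.count_add, Multiset.count_replicate] at hcount
    have hnodup : ((Finset.univ : Finset (Fin (n + 1))).val.map y).Nodup :=
      Finset.univ.nodup.map hinj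
    by_cases hb : x = b
    · subst hb
      rw [if_pos rfl, Multiset.count_eq_zero_of_notMem (fun hmem => by
        obtain ⟨i, -, hi⟩ := Multiset.mem_map.1 hmem
        exact hxy i hi.symm)]
        at hcount
      exact (hP a (by omega)).symm
    · rw [if_neg hb] at hcount
      have h1 := Multiset.nodup_iff_count_le_one.1 hnodup b
      obtain rfl : a = 0 := by omega
      have hmem := Multiset.count_pos.1 (by omega : 0 < Multiset.count b
        ((Finset.univ : Finset (Fin (n + 1))).val.map y))
      obtain ⟨i, -, rfl⟩ := Multiset.mem_map.1 hmem
      simp [taylor_coeff_zero, hPy i (Finset.mem_univ i)]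
  have hsub : ∀ S : Finset (Fin (n + 1)),
      S.val.map y ≤ (Finset.univ : Finset (Fin (n + 1))).val.map y := fun S =>
    Multiset.map_le_map (Finset.val_le_iff.2 (Finset.subset_univ S))
  have hder : ∀ m, iteratedDeriv m (fun t : ℝ => ∏ i, (t - y i)) x / (m.factorial : ℝ) =
      (taylor x (Lagrange.nodal Finset.univ y)).coeff m := fun m => by
    rw [← iteratedDeriv_eval_div_factorial]
    simp only [Lagrange.eval_nodal]
  have htail : ∀ m ∈ Finset.range (k + 1),
      divDiff (Set.Icc p q) f
          (Multiset.replicate (k + 1 - m) x + (Finset.univ : Finset (Fin (n + 1))).val.map y) *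
        (iteratedDeriv m (fun t : ℝ => ∏ i, (t - y i)) x / (m.factorial : ℝ)) =
      polyDivDiff P
          (Multiset.replicate (k + 1 - m) x + (Finset.univ : Finset (Fin (n + 1))).val.map y) *
        (taylor x (Lagrange.nodal Finset.univ y)).coeff m := fun m hm => by
    rw [hder, hdd _ (by simp)
      (by gcongr; exact Nat.sub_le _ _)]
  rw [← hP k k.lt_succ_self]
  constructor
  · rw [taylor_coeff_eq_sum_cons_add_sum x k hv P]
    congr 1
    · refine Finset.sum_congr rfl fun S _ => ?_
      rw [Finset.compl_eq_univ_sdiff, hdd _ Multiset.cons_ne_zero]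
      rw [← Multiset.singleton_add, ← Multiset.replicate_one]
      exact add_le_add ((Multiset.replicate_le_replicate x).2 (by omega)) (hsub S)
    · exact Finset.sum_congr rfl fun m hm =>
        (htail m (Finset.range_subset_range.2 k.le_succ hm)).symm
  · rw [taylor_coeff_eq_sum_add_sum x k hv P]
    congr 1
    · refine Finset.sum_congr rfl fun S hS => ?_
      rw [Finset.compl_eq_univ_sdiff, hdd _ _ ((hsub S).trans (Multiset.le_add_left _ _))]
      rw [← Multiset.card_pos, Multiset.card_map, Finset.card_val,
        (Finset.mem_powersetCard.1 hS).2]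
      omega
    · exact Finset.sum_congr rfl fun m hm => (htail m hm).symm
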